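/- Let $n\ge 1$, $1\le k\le n$, let $\Omega\subset\mathbb R^n$ be a bounded polyhedral domain, and let $\{\mathcal T_h\}$ be a shape-regular family of simplicial meshes of $\Omega$ (that is, $(\operatorname{diam}T)^n/|T|$ is bounded uniformly over all $h$ and all $n$-simplices $T\in\mathcal T_h$). For $0\le j\le n$ equip $L^2\Lambda^j(\Omega)$, the space of square-integrable $j$-forms on $\Omega$, with the inner product $\langle u,v\rangle=\int_\Omega\langle u_x,v_x\rangle_{\mathrm{Alt}}\,dx$ and its norm $\|\cdot\|$, where $\langle a,b\rangle_{\mathrm{Alt}}=\sum_{\sigma}a(e_{\sigma_1},\dots,e_{\sigma_j})\,b(e_{\sigma_1},\dots,e_{\sigma_j})$, the sum being over all increasing maps $\sigma:\{1,\dots,j\}\to\{1,\dots,n\}$. Let $d$ be the (distributional) exterior derivative, with domain $H\Lambda^j(\Omega)=\{u\in L^2\Lambda^j(\Omega): du\in L^2\Lambda^{j+1}(\Omega)\}$. Put $$V_h^{k-1}=\mathcal P_1\Lambda^{k-1}(\mathcal T_h)=\{u\in H\Lambda^{k-1}(\Omega): u|_T \text{ is a polynomial form of degree}\le 1 \text{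 for all } T\in\mathcal T_h\},$$ $$V_h^{k}=\mathcal P_1^-\Lambda^{k}(\mathcal T_h)=\{u\in H\Lambda^{k}(\Omega): \text{for all } T\in\mathcal T_h \text{ there are } a\in\mathrm{Alt}^k(\mathbb R^n),\ b\in\mathrm{Alt}^{k+1}(\mathbb R^n) \text{ with } u_x=a+b(x,\cdot,\dots,\cdot) \text{ on } T\},$$ $$W_h^{k-1}=\{\tau\in L^2\Lambda^{k-1}(\Omega): \tau|_T \text{ is constant for all } T\in\mathcal T_h\}.$$ For $(k-1)$-forms $u,v$ on $\Omega$ that are polynomial of degree $\le 1$ on each $T\in\mathcal T_h$ put $$\langle u,v\rangle_h=\sum_{T\in\mathcal T_h}\frac{|T|}{n+1}\sum_{x\in\Delta_0(T)}\langle u_x,v_x\rangle_{\mathrm{Alt}},$$ where $\Delta_0(T)$ is the set of vertices of $T$ and $u_x$, $v_x$ are the values at $x$ of the polynomial forms $u|_T$, $v|_T$. Then $V_h^{k-1}\subset H\Lambda^{k-1}(\Omega)$ and $V_h^k\subset H\Lambda^k(\Omega)$ are finite-dimensional, $d(V_h^{k-1})\subset V_h^k$, and the following two conditions hold. **(A)**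 (Stability.) $\langle\cdot,\cdot\rangle_h$ is a symmetric, bounded, coercive bilinear form on $V_h^{k-1}$, and the norm $\|\tau\|_h=\langle\tau,\tau\rangle_h^{1/2}$ is equivalent to $\|\tau\|$ on $V_h^{k-1}$, all with constants independent of $h$. **(B)** (Consistency.) With the finite-dimensional space $W_h^{k-1}\subset L^2\Lambda^{k-1}(\Omega)$ and with $\tilde V_h^{k-1}=V_h^{k-1}$ one has $$\langle\tau,\tau_0\rangle=\langle\tau,\tau_0\rangle_h\qquad\text{for all }\tau\in\tilde V_h^{k-1},\ \tau_0\in W_h^{k-1},$$ and there are linear maps $\Pi_h:V_h^{k-1}\to\tilde V_h^{k-1}$ and a constant $C$ independent of $h$ such that, for all $\tau\in V_h^{k-1}$, $d\Pi_h\tau=d\tau$, $\|\Pi_h\tau\|\le C\|\tau\|$, and $\langle\Pi_h\tau,\tau_0\rangle_h=\langle\tau,\tau_0\rangle_h$ for all $\tau_0\in W_h^{k-1}$. -/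

import Mathlib

open MeasureTheory Set Filter Topology
open scoped ContDiff InnerProductSpace

noncomputable section

namespace FEEC

/-! ### Alternating forms on `ℝⁿ` and their inner product -/

/-- `ℝⁿ` with the Euclidean norm. -/
abbrev E (n : ℕ) : Type := EuclideanSpace ℝ (Fin n)

/-- `Alt^k(ℝⁿ)`: alternating `k`-linear maps on `ℝⁿ` with real values. -/
abbrev Alt (n k : ℕ) : Type := E n [⋀^Fin k]→ₗ[ℝ] ℝ

/-- The standard basis vectors `(e_{σ 1}, …, e_{σ k})` selected by `σ`. -/
def basisTuple {n k : ℕ} (σ : Fin k → Fin n) : Fin k → E n :=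
  fun i => EuclideanSpace.basisFun (Fin n) ℝ (σ i)

/-- The inner product on `Alt^k(ℝⁿ)`: the sum of `a(e_σ) b(e_σ)` over all strictly increasing
maps `σ` from `{1, …, k}` to `{1, …, n}`. -/
def altInner {n k : ℕ} (a b : Alt n k) : ℝ :=
  ∑ σ : Fin k ↪o Fin n, a (basisTuple σ) * b (basisTuple σ)

/-- An alternating form that vanishes on all increasing tuples of basis vectors is zero. -/
theorem eq_zero_of_basisTuple {n k : ℕ} (a : Alt n k)
    (h : ∀ σ : Fin k ↪o Fin n, a (basisTuple σ) = 0) : a = 0 := by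
  refine Module.Basis.ext_alternating (EuclideanSpace.basisFun (Fin n) ℝ).toBasis fun v hv => ?_
  have hmono : StrictMono (v ∘ Tuple.sort v) :=
    (Tuple.monotone_sort v).strictMono_of_injective (hv.comp (Tuple.sort v).injective)
  have h1 := h (OrderEmbedding.ofStrictMono _ hmono)
  have h2 := a.map_perm (basisTuple v) (Tuple.sort v)
  have h3 : a (basisTuple v ∘ Tuple.sort v) = 0 := h1
  rw [h3] at h2
  have h4 : a (basisTuple v) = 0 := by
    rcases Int.units_eq_one_or (Equiv.Perm.sign (Tuple.sort v)) with hs | hs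
    · rw [hs] at h2; simpa using h2.symm
    · rw [hs] at h2; simpa using h2.symm
  rw [OrthonormalBasis.coe_toBasis]
  exact h4

abbrev altCore (n k : ℕ) : InnerProductSpace.Core ℝ (Alt n k) where
  inner := altInner
  conj_inner_symm a b := by simp [altInner, mul_comm]
  re_inner_nonneg a := by
    exact Finset.sum_nonneg fun σ _ => mul_self_nonneg (a (basisTuple σ))
  add_left a b c := by simp [altInner, add_mul, Finset.sum_add_distrib]
  smul_left a b r := by simp [altInner, Finset.mul_sum, mul_assoc]
  definite a h := by
    refine eq_zero_of_basisTuple a fun σ => ?_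
    have h' : ∑ σ : Fin k ↪o Fin n, a (basisTuple σ) * a (basisTuple σ) = 0 := h
    rw [Finset.sum_eq_zero_iff_of_nonneg fun σ _ => mul_self_nonneg _] at h'
    exact mul_self_eq_zero.mp (h' σ (Finset.mem_univ σ))

instance altNormedAddCommGroup (n k : ℕ) : NormedAddCommGroup (Alt n k) :=
  (altCore n k).toNormedAddCommGroup

instance altInnerProductSpace (n k : ℕ) : InnerProductSpace ℝ (Alt n k) :=
  InnerProductSpace.ofCore (altCore n k).toCore

instance altFiniteDimensional (n k : ℕ) : FiniteDimensional ℝ (Alt n k) :=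
  FiniteDimensional.of_injective
    ({ toFun := fun a => a.toMultilinearMap
       map_add' := fun _ _ => rfl
       map_smul' := fun _ _ => rfl } :
      Alt n k →ₗ[ℝ] MultilinearMap ℝ (fun _ : Fin k => E n) ℝ)
    fun _ _ h => AlternatingMap.coe_multilinearMap_injective h

theorem altInner_eq {n k : ℕ} (a b : Alt n k) : ⟪a, b⟫_ℝ = altInner a b := rfl

/-- Evaluation of a form at a tuple of vectors. -/
def evalAt {n k : ℕ} (t : Fin k → E n) : Alt n k →L[ℝ] ℝ :=
  LinearMap.toContinuousLinearMap
    { toFun := fun a => a t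
      map_add' := fun _ _ => rfl
      map_smul' := fun _ _ => rfl }

theorem evalAt_apply {n k : ℕ} (t : Fin k → E n) (a : Alt n k) : evalAt t a = a t := rfl

/-! ### The `L²` de Rham complex -/

/-- `L²Λ^k(Ω)`, with `⟪u, v⟫ = ∫_Ω ⟪u_x, v_x⟫_Alt dx` and the associated norm. -/
abbrev L2Form {n : ℕ} (Ω : Set (E n)) (k : ℕ) : Type :=
  Lp (Alt n k) 2 (volume.restrict Ω)

/-- `w` is the exterior derivative of `u` on `Ω` in the sense of distributions, i.e.
`w_x(t₁, …, t_{k+1}) = ∑ⱼ (-1)^{j+1} ∂_{tⱼ} u_x(t₁, …, t̂ⱼ, …, t_{k+1})`, tested against smooth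
functions with compact support in `Ω` (here `j` is counted from `0`). -/
def IsWeakExtDeriv {n k : ℕ} (Ω : Set (E n)) (u : E n → Alt n k) (w : E n → Alt n (k + 1)) :
    Prop :=
  ∀ φ : E n → ℝ, ContDiff ℝ ∞ φ → HasCompactSupport φ → tsupport φ ⊆ Ω →
    ∀ t : Fin (k + 1) → E n,
      ∑ j : Fin (k + 1), (-1 : ℝ) ^ (j : ℕ) *
          ∫ x in Ω, u x (j.removeNth t) * fderiv ℝ φ x (t j) =
        -∫ x in Ω, w x t * φ x

theorem integrable_eval_mul {n k : ℕ} {Ω : Set (E n)} (u : L2Form Ω k) (t : Fin k → E n)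
    {g : E n → ℝ} (hg : Continuous g) (hgs : HasCompactSupport g) :
    Integrable (fun x => u x t * g x) (volume.restrict Ω) := by
  have h1 : MemLp (fun x => evalAt t (u x)) 2 (volume.restrict Ω) :=
    (evalAt t).comp_memLp' (Lp.memLp u)
  have h2 : MemLp g 2 (volume.restrict Ω) := (hg.memLp_of_hasCompactSupport hgs).restrict Ω
  exact h1.integrable_mul h2

theorem fderiv_apply_props {n : ℕ} {φ : E n → ℝ} (h : ContDiff ℝ ∞ φ) (hs : HasCompactSupport φ)
    (v : E n) : Continuous (fun x => fderiv ℝ φ x v) ∧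
      HasCompactSupport (fun x => fderiv ℝ φ x v) :=
  ⟨(h.continuous_fderiv (by simp)).clm_apply continuous_const, hs.fderiv_apply ℝ v⟩

/-- The graph of the exterior derivative `d^k` as an unbounded operator on `L²Λ^k(Ω)`. -/
def extDerivGraph {n : ℕ} (Ω : Set (E n)) (k : ℕ) :
    Submodule ℝ (L2Form Ω k × L2Form Ω (k + 1)) where
  carrier := {p | IsWeakExtDeriv Ω p.1 p.2}
  zero_mem' := by
    intro φ _ _ _ t
    have h0 : ∀ m : ℕ, ∀ᵐ x ∂(volume.restrict Ω), (0 : L2Form Ω m) x = 0 := fun m =>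
      Lp.coeFn_zero _ _ _
    have h1 : ∀ j : Fin (k + 1), ∫ x in Ω, ((0 : L2Form Ω k) x) (j.removeNth t) *
        fderiv ℝ φ x (t j) = 0 := fun j => by
      refine integral_eq_zero_of_ae ?_
      filter_upwards [h0 k] with x hx
      simp only [hx, AlternatingMap.zero_apply, zero_mul, Pi.zero_apply]
    have h2 : ∫ x in Ω, ((0 : L2Form Ω (k + 1)) x) t * φ x = 0 := by
      refine integral_eq_zero_of_ae ?_
      filter_upwards [h0 (k + 1)] with x hx
      simp only [hx, AlternatingMap.zero_apply, zero_mul, Pi.zero_apply]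
    simp only [Prod.fst_zero, Prod.snd_zero, h1, h2]
    simp
  add_mem' := by
    rintro ⟨u, w⟩ ⟨u', w'⟩ hu hu' φ hφ hc hs t
    have e1 : ∀ j : Fin (k + 1), ∫ x in Ω, (u + u') x (j.removeNth t) * fderiv ℝ φ x (t j) =
        (∫ x in Ω, u x (j.removeNth t) * fderiv ℝ φ x (t j)) +
          ∫ x in Ω, u' x (j.removeNth t) * fderiv ℝ φ x (t j) := fun j => by
      obtain ⟨c1, c2⟩ := fderiv_apply_props hφ hc (t j)
      rw [← integral_add (integrable_eval_mul u _ c1 c2) (integrable_eval_mul u' _ c1 c2)]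
      refine integral_congr_ae ?_
      filter_upwards [Lp.coeFn_add u u'] with x hx
      simp only [hx, Pi.add_apply, AlternatingMap.add_apply, add_mul]
    have e2 : ∫ x in Ω, (w + w') x t * φ x =
        (∫ x in Ω, w x t * φ x) + ∫ x in Ω, w' x t * φ x := by
      rw [← integral_add (integrable_eval_mul w _ hφ.continuous hc)
        (integrable_eval_mul w' _ hφ.continuous hc)]
      refine integral_congr_ae ?_
      filter_upwards [Lp.coeFn_add w w'] with x hx
      simp only [hx, Pi.add_apply, AlternatingMap.add_apply, add_mul]
    have a1 := hu φ hφ hc hs t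
    have a2 := hu' φ hφ hc hs t
    simp only [Prod.fst_add, Prod.snd_add, e1, e2, mul_add, Finset.sum_add_distrib] at a1 a2 ⊢
    rw [a1, a2]
    ring
  smul_mem' := by
    rintro c ⟨u, w⟩ hu φ hφ hc hs t
    have e1 : ∀ j : Fin (k + 1), ∫ x in Ω, (c • u) x (j.removeNth t) * fderiv ℝ φ x (t j) =
        c * ∫ x in Ω, u x (j.removeNth t) * fderiv ℝ φ x (t j) := fun j => by
      rw [← integral_const_mul]
      refine integral_congr_ae ?_
      filter_upwards [Lp.coeFn_smul c u] with x hx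
      simp only [hx, Pi.smul_apply, AlternatingMap.smul_apply, smul_eq_mul, mul_assoc]
    have e2 : ∫ x in Ω, (c • w) x t * φ x = c * ∫ x in Ω, w x t * φ x := by
      rw [← integral_const_mul]
      refine integral_congr_ae ?_
      filter_upwards [Lp.coeFn_smul c w] with x hx
      simp only [hx, Pi.smul_apply, AlternatingMap.smul_apply, smul_eq_mul, mul_assoc]
    have a1 := hu φ hφ hc hs t
    simp only [Prod.smul_fst, Prod.smul_snd, e1, e2] at a1 ⊢
    simp only [mul_left_comm _ c, ← Finset.mul_sum, a1]
    ring

/-- The weak exterior derivative is unique, so that `extDerivGraph` is the graph of an operator. -/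
theorem extDerivGraph_functional {n : ℕ} {Ω : Set (E n)} (hΩ : IsOpen Ω) (k : ℕ)
    (p : L2Form Ω k × L2Form Ω (k + 1)) (hp : p ∈ extDerivGraph Ω k) (h0 : p.1 = 0) :
    p.2 = 0 := by
  obtain ⟨u, w⟩ := p
  obtain rfl : u = 0 := h0
  have hw : ∀ (φ : E n → ℝ), ContDiff ℝ ∞ φ → HasCompactSupport φ → tsupport φ ⊆ Ω →
      ∀ t : Fin (k + 1) → E n, ∫ x in Ω, w x t * φ x = 0 := by
    intro φ hφ hc hs t
    have a := hp φ hφ hc hs t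
    have b := (extDerivGraph Ω k).zero_mem φ hφ hc hs t
    have z : ∫ x in Ω, ((0 : L2Form Ω (k + 1)) x) t * φ x = 0 := by
      refine integral_eq_zero_of_ae ?_
      have hz : ∀ᵐ x ∂(volume.restrict Ω), (0 : L2Form Ω (k + 1)) x = 0 := Lp.coeFn_zero _ _ _
      filter_upwards [hz] with x hx
      simp only [hx, AlternatingMap.zero_apply, zero_mul, Pi.zero_apply]
    simp only [Prod.fst_zero, Prod.snd_zero] at a b
    rw [b, z] at a
    linarith
  have key : ∀ t : Fin (k + 1) → E n, ∀ᵐ x ∂(volume.restrict Ω), w x t = 0 := by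
    intro t
    have hm : MemLp (fun x => evalAt t (w x)) 2 (volume.restrict Ω) :=
      (evalAt t).comp_memLp' (Lp.memLp w)
    have hloc : LocallyIntegrableOn (fun x => w x t) Ω volume := by
      rw [locallyIntegrableOn_iff hΩ.isLocallyClosed]
      intro K hK hKc
      have h1 : MemLp (fun x => evalAt t (w x)) 2 (volume.restrict K) :=
        hm.mono_measure (Measure.restrict_mono hK le_rfl)
      have : IsFiniteMeasure (volume.restrict K) :=
        ⟨by simpa using hKc.measure_lt_top⟩
      exact h1.integrable (by norm_num)
    have := hΩ.ae_eq_zero_of_integral_contDiff_smul_eq_zero hloc fun g hg hgc hgs => by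
      rw [← setIntegral_eq_integral_of_forall_compl_eq_zero (s := Ω)]
      · simpa [mul_comm] using hw g hg hgc hgs t
      · intro x hx
        have : g x = 0 := image_eq_zero_of_notMem_tsupport fun h => hx (hgs h)
        simp [this]
    exact (ae_restrict_iff' hΩ.measurableSet).2 this
  have hall : ∀ᵐ x ∂(volume.restrict Ω), ∀ σ : Fin (k + 1) ↪o Fin n, w x (basisTuple σ) = 0 :=
    ae_all_iff.2 fun σ => key _
  refine (Lp.eq_zero_iff_ae_eq_zero).2 ?_
  filter_upwards [hall] with x hx
  exact eq_zero_of_basisTuple _ hx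

/-- The exterior derivative `d^k`, an unbounded operator from `L²Λ^k(Ω)` to `L²Λ^{k+1}(Ω)` whose
domain is `HΛ^k(Ω)`, the space of all `u ∈ L²Λ^k(Ω)` with `du ∈ L²Λ^{k+1}(Ω)`. -/
def extD {n : ℕ} (Ω : Set (E n)) (k : ℕ) : L2Form Ω k →ₗ.[ℝ] L2Form Ω (k + 1) :=
  (extDerivGraph Ω k).toLinearPMap

/-! ### Polyhedral domains and simplicial meshes -/

/-- A bounded polyhedral domain: a bounded, connected, nonempty open set whose boundary lies in
finitely many affine hyperplanes (proper affine subspaces). -/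
structure IsPolyhedralDomain {n : ℕ} (Ω : Set (E n)) : Prop where
  isOpen : IsOpen Ω
  isConnected : IsConnected Ω
  isBounded : Bornology.IsBounded Ω
  boundary : ∃ S : Finset (AffineSubspace ℝ (E n)), (∀ A ∈ S, A ≠ ⊤) ∧
    frontier Ω ⊆ ⋃ A ∈ S, (A : Set (E n))

/-- A simplicial mesh of `Ω`: a finite set of nondegenerate `n`-simplices with union `closure Ω`,
any two of which meet in a common subsimplex or not at all. It is given as a finite simplicial
complex in which each simplex is a subsimplex of an `n`-simplex. -/
structure SimplicialMesh {n : ℕ} (Ω : Set (E n)) where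
  complex : Geometry.SimplicialComplex ℝ (E n)
  finite : complex.faces.Finite
  pure : ∀ s ∈ complex.faces, ∃ T ∈ complex.faces, s ⊆ T ∧ T.card = n + 1
  space_eq : complex.space = closure Ω

/-- The `n`-simplices of the mesh, each given by its set of vertices. -/
def SimplicialMesh.cells {n : ℕ} {Ω : Set (E n)} (M : SimplicialMesh Ω) : Finset (Finset (E n)) :=
  M.finite.toFinset.filter fun T => T.card = n + 1

/-- The closed simplex with the given vertices. -/
abbrev simplex {n : ℕ} (T : Finset (E n)) : Set (E n) := convexHull ℝ (T : Set (E n))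

/-- A family of meshes is shape-regular if `(diam T)ⁿ / |T|` is bounded uniformly over all
`n`-simplices `T` of all meshes of the family. -/
def ShapeRegular {n : ℕ} {Ω : Set (E n)} {ι : Type*} (M : ι → SimplicialMesh Ω) : Prop :=
  ∃ γ : ℝ, ∀ i, ∀ T ∈ (M i).cells,
    Metric.diam (simplex T) ^ n ≤ γ * volume.real (simplex T)

/-! ### Finite element spaces -/

/-- `P₁Λ^k(ℝⁿ)`: polynomial forms `u(x) = a₀ + ∑ⱼ aⱼ xⱼ` with `aⱼ ∈ Alt^k(ℝⁿ)`, that is, affine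
maps from `ℝⁿ` to `Alt^k(ℝⁿ)`. -/
abbrev P1Form (n k : ℕ) : Type := E n →ᵃ[ℝ] Alt n k

/-- `P₀Λ^k(ℝⁿ)`: the constant forms. -/
def constForms (n k : ℕ) : Submodule ℝ (P1Form n k) where
  carrier := {p | ∃ a : Alt n k, ∀ x, p x = a}
  zero_mem' := ⟨0, fun _ => rfl⟩
  add_mem' := by
    rintro p q ⟨a, ha⟩ ⟨b, hb⟩
    exact ⟨a + b, fun x => by simp [ha, hb]⟩
  smul_mem' := by
    rintro c p ⟨a, ha⟩
    exact ⟨c • a, fun x => by simp [ha]⟩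

/-- `P₁⁻Λ^k(ℝⁿ) = P₀Λ^k(ℝⁿ) + κ P₀Λ^{k+1}(ℝⁿ)`, where `(κ b)_x = b(x, ·, …, ·)` is the Koszul
operator: the Whitney forms. -/
def whitneyForms (n k : ℕ) : Submodule ℝ (P1Form n k) where
  carrier := {p | ∃ (a : Alt n k) (b : Alt n (k + 1)), ∀ x, p x = a + b.curryLeft x}
  zero_mem' := ⟨0, 0, fun x => by ext t; simp⟩
  add_mem' := by
    rintro p q ⟨a, b, h⟩ ⟨a', b', h'⟩
    refine ⟨a + a', b + b', fun x => ?_⟩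
    rw [AlternatingMap.curryLeft_add, LinearMap.add_apply, AffineMap.coe_add, Pi.add_apply, h, h']
    abel
  smul_mem' := by
    rintro c p ⟨a, b, h⟩
    refine ⟨c • a, c • b, fun x => ?_⟩
    rw [AlternatingMap.curryLeft_smul, LinearMap.smul_apply, AffineMap.coe_smul, Pi.smul_apply, h,
      smul_add]

variable {n : ℕ} {Ω : Set (E n)}

/-- `u` agrees with the polynomial form `p` on the simplex `T` (almost everywhere). -/
def AgreesOn {k : ℕ} (u : L2Form Ω k) (T : Finset (E n)) (p : P1Form n k) : Prop :=
  ∀ᵐ x ∂(volume.restrict Ω), x ∈ simplex T → u x = p x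

/-- The space of all `u ∈ L²Λ^k(Ω)` whose restriction to each `n`-simplex of the mesh belongs to
the given space `S` of polynomial forms; no continuity is imposed. -/
def brokenForms (M : SimplicialMesh Ω) {k : ℕ} (S : Submodule ℝ (P1Form n k)) :
    Submodule ℝ (L2Form Ω k) where
  carrier := {u | ∀ T ∈ M.cells, ∃ p ∈ S, AgreesOn u T p}
  zero_mem' := fun T _ => ⟨0, S.zero_mem, by
    have h : ∀ᵐ x ∂(volume.restrict Ω), (0 : L2Form Ω k) x = 0 := Lp.coeFn_zero _ _ _
    filter_upwards [h] with x hx _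
    rw [hx]
    rfl⟩
  add_mem' := by
    intro u v hu hv T hT
    obtain ⟨p, hp, hup⟩ := hu T hT
    obtain ⟨q, hq, hvq⟩ := hv T hT
    refine ⟨p + q, S.add_mem hp hq, ?_⟩
    filter_upwards [Lp.coeFn_add u v, hup, hvq] with x h1 h2 h3 hx
    rw [h1, Pi.add_apply, h2 hx, h3 hx]
    rfl
  smul_mem' := by
    intro c u hu T hT
    obtain ⟨p, hp, hup⟩ := hu T hT
    refine ⟨c • p, S.smul_mem c hp, ?_⟩
    filter_upwards [Lp.coeFn_smul c u, hup] with x h1 h2 hx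
    rw [h1, Pi.smul_apply, h2 hx]
    rfl

/-- `P₁Λ^k(𝒯_h)`: all elements of `HΛ^k(Ω)` which restrict to elements of `P₁Λ^k` on each `T`. -/
def P1Space (M : SimplicialMesh Ω) (k : ℕ) : Submodule ℝ (L2Form Ω k) :=
  (extD Ω k).domain ⊓ brokenForms M ⊤

/-- `P₁⁻Λ^k(𝒯_h)`: all elements of `HΛ^k(Ω)` which restrict to elements of `P₁⁻Λ^k` on each `T`. -/
def P1MinusSpace (M : SimplicialMesh Ω) (k : ℕ) : Submodule ℝ (L2Form Ω k) :=
  (extD Ω k).domain ⊓ brokenForms M (whitneyForms n k)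

/-- `W_h^k`: all elements of `L²Λ^k(Ω)` which are constant on each `T`. -/
def P0Space (M : SimplicialMesh Ω) (k : ℕ) : Submodule ℝ (L2Form Ω k) :=
  brokenForms M (constForms n k)

/-! ### The vertex quadrature -/

open scoped Classical in
/-- The polynomial form that `u` is equal to on the simplex `T` (and `0` if there is none). Its
value at a vertex `x` of `T` is the value `u_x` of `u` at `x`, taken in `T`. -/
def localForm {k : ℕ} (u : L2Form Ω k) (T : Finset (E n)) : P1Form n k :=
  if h : ∃ p : P1Form n k, AgreesOn u T p then h.choose else 0

/-- `⟨u, v⟩_{h,T} = |T| / (n+1) ∑_x ⟨u_x, v_x⟩_Alt`, the sum being over the vertices `x` of `T`. -/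
def quadCell {k : ℕ} (T : Finset (E n)) (u v : L2Form Ω k) : ℝ :=
  volume.real (simplex T) / (n + 1) * ∑ x ∈ T, ⟪localForm u T x, localForm v T x⟫_ℝ

/-- `⟨u, v⟩_h`, the sum of `⟨u, v⟩_{h,T}` over all `n`-simplices `T` of the mesh. -/
def quadForm (M : SimplicialMesh Ω) {k : ℕ} (u v : L2Form Ω k) : ℝ :=
  ∑ T ∈ M.cells, quadCell T u v

/-! ### The abstract conditions -/

section Abstract

variable {W W' W'' : Type*} [NormedAddCommGroup W] [InnerProductSpace ℝ W]
  [NormedAddCommGroup W'] [InnerProductSpace ℝ W'] [NormedAddCommGroup W'']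
  [InnerProductSpace ℝ W''] {ι : Type*}

/-- The segment `V → V'` is a finite-dimensional subcomplex of the domain complex of
`d : W → W'`, `d' : W' → W''`. -/
structure IsDiscreteSegment (d : W →ₗ.[ℝ] W') (d' : W' →ₗ.[ℝ] W'') (V : Submodule ℝ W)
    (V' : Submodule ℝ W') : Prop where
  finiteDimensional : FiniteDimensional ℝ V
  finiteDimensional' : FiniteDimensional ℝ V'
  le_domain : V ≤ d.domain
  le_domain' : V' ≤ d'.domain
  map_mem : ∀ τ : d.domain, (τ : W) ∈ V → d τ ∈ V'

/-- Condition (A) for the family of spaces `V i` and forms `b i`: each `b i` is a symmetric,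
bounded and coercive bilinear form on `V i`, and `τ ↦ b(τ, τ)^{1/2}` is equivalent to the norm
on `V i`, all with constants that do not depend on `i`. -/
structure StabilityCondition (V : ι → Submodule ℝ W) (b : ι → W → W → ℝ) : Prop where
  add_left : ∀ i, ∀ σ ∈ V i, ∀ σ' ∈ V i, ∀ τ ∈ V i, b i (σ + σ') τ = b i σ τ + b i σ' τ
  smul_left : ∀ i, ∀ c : ℝ, ∀ σ ∈ V i, ∀ τ ∈ V i, b i (c • σ) τ = c * b i σ τ
  symm : ∀ i, ∀ σ ∈ V i, ∀ τ ∈ V i, b i σ τ = b i τ σ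
  bounded : ∃ C > 0, ∀ i, ∀ σ ∈ V i, ∀ τ ∈ V i, |b i σ τ| ≤ C * ‖σ‖ * ‖τ‖
  coercive : ∃ c > 0, ∀ i, ∀ τ ∈ V i, c * ‖τ‖ ^ 2 ≤ b i τ τ
  norm_equiv : ∃ c > 0, ∃ C > 0, ∀ i, ∀ τ ∈ V i,
    c * ‖τ‖ ≤ √(b i τ τ) ∧ √(b i τ τ) ≤ C * ‖τ‖

/-- Condition (B) for the family of spaces `V i` and forms `b i`, with the discrete spaces
`Wh i ⊆ W` and `Vt i ⊆ V i`: `⟨τ, τ₀⟩ = b(τ, τ₀)` for `τ ∈ Vt i`, `τ₀ ∈ Wh i`, and there are linear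
maps `P i : V i → Vt i`, bounded independently of `i`, with `d (P τ) = d τ` and
`b(P τ, τ₀) = b(τ, τ₀)` for `τ₀ ∈ Wh i`. -/
structure ConsistencyCondition (d : W →ₗ.[ℝ] W') (V : ι → Submodule ℝ W)
    (b : ι → W → W → ℝ) (Wh Vt : ι → Submodule ℝ W) : Prop where
  finiteDimensional_Wh : ∀ i, FiniteDimensional ℝ (Wh i)
  Vt_le : ∀ i, Vt i ≤ V i
  exact : ∀ i, ∀ τ ∈ Vt i, ∀ τ₀ ∈ Wh i, ⟪τ, τ₀⟫_ℝ = b i τ τ₀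
  exists_map : ∃ P : ∀ i, V i →ₗ[ℝ] Vt i,
    (∀ i (τ : V i), ∃ (h₁ : (P i τ : W) ∈ d.domain) (h₂ : (τ : W) ∈ d.domain),
      d ⟨P i τ, h₁⟩ = d ⟨τ, h₂⟩) ∧
    (∃ C > 0, ∀ i (τ : V i), ‖(P i τ : W)‖ ≤ C * ‖(τ : W)‖) ∧
    ∀ i (τ : V i), ∀ τ₀ ∈ Wh i, b i (P i τ) τ₀ = b i τ τ₀

end Abstract

end FEEC

end

open FEEC

/-!
# Stability and consistency of the vertex quadrature

The vertex quadrature is compared with the `L²` inner product simplex by simplex, and no scaling to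
a reference simplex is needed.

* The affine map exchanging two vertices of a simplex and fixing the others is an involution, so it
  preserves volume. Hence all barycentric coordinates have the same integral, and the vertex
  quadrature is exact for affine functions (`integral_affine`). As `⟪τ, τ₀⟫` is affine on each cell
  when `τ` is affine and `τ₀` constant there, this is the consistency identity.
* The function `‖p‖²` is convex for affine `p`, so the quadrature overestimates its integral
  (`integral_norm_sq_le`). Conversely `p v = 2 p ((x + v) / 2) - p x` for a vertex `v`, and
  integrating over `x` bounds `‖p v‖²` by the mean of `‖p‖²`, with a factor that depends on the
  dimension only (`norm_sq_apply_vertex_le`). Together: `‖τ‖² ≤ ⟨τ, τ⟩_h ≤ (2ⁿ⁺³ + 2) ‖τ‖²` for all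
  piecewise affine `τ`, and boundedness follows by the Cauchy–Schwarz inequality. The constants
  depend on neither the mesh nor its shape.
* As the test space `Ṽ_h` is all of `P₁Λ^k(𝒯_h)`, the identity serves as `Π_h`.

To sum these local facts, the boundary of a polyhedral domain and the intersection of two distinct
cells are null sets, and the form that `u` agrees with on a cell `T` is unique, as `T` meets `Ω` in
a set with nonempty interior. So the vertex values on the cells depend linearly on `u` and determine
it, which gives finite dimension.

For the subcomplex property, integration by parts against test functions supported inside a cell
shows that `du` is there the constant form obtained by alternating the linear part of `u`
(`IsWeakExtDeriv.ae_eq_of_affine`), and constant forms are Whitney forms. Moreover `du` lies in the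
domain of the next `d`, as `d ∘ d = 0` holds weakly by the symmetry of second derivatives
(`IsWeakExtDeriv.isWeakExtDeriv_zero`).
-/

noncomputable section

namespace FEEC

/-! ### Integration of affine maps over a simplex -/

section Simplex

variable {V F J : Type*} [NormedAddCommGroup V] [NormedSpace ℝ V] [Fintype J]
  [NormedAddCommGroup F] [InnerProductSpace ℝ F]

theorem isCompact_convexHull_range (b : AffineBasis J ℝ V) : IsCompact (convexHull ℝ (range b)) :=
  (finite_range b).isCompact_convexHull ℝ

theorem apply_eq_sum_coord (b : AffineBasis J ℝ V) (p : V →ᵃ[ℝ] F) (x : V) :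
    p x = ∑ i, b.coord i x • p (b i) := by
  have h1 : ∑ i, b.coord i x = 1 := b.sum_coord_apply_eq_one x
  conv_lhs => rw [← b.affineCombination_coord_eq_self x]
  rw [Finset.map_affineCombination _ _ _ h1,
    Finset.affineCombination_eq_linear_combination _ _ _ h1]
  rfl

variable [MeasurableSpace V] [BorelSpace V]

theorem integrableOn_convexHull (b : AffineBasis J ℝ V) (μ : Measure V)
    [IsFiniteMeasureOnCompacts μ] {f : V → ℝ} (hf : Continuous f) :
    IntegrableOn f (convexHull ℝ (range b)) μ :=
  hf.continuousOn.integrableOn_compact (isCompact_convexHull_range b)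

variable [FiniteDimensional ℝ V] (μ : Measure V) [μ.IsAddHaarMeasure]

/-- All barycentric coordinates have the same integral over the simplex: the affine map which
exchanges two vertices and fixes the others is an involution, so it preserves the volume. -/
theorem integral_coord_eq_integral_coord (b : AffineBasis J ℝ V) (i j : J) :
    ∫ x in convexHull ℝ (range b), b.coord i x ∂μ =
      ∫ x in convexHull ℝ (range b), b.coord j x ∂μ := by
  classical
  rcases eq_or_ne i j with rfl | hij
  · rfl
  set S := convexHull ℝ (range b)
  let w : V := b j - b i
  let φ : V →L[ℝ] ℝ := LinearMap.toContinuousLinearMap ((b.coord i).linear - (b.coord j).linear)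
  let f : V → V := fun x => x + (b.coord i x - b.coord j x) • w
  let L : V →L[ℝ] V := ContinuousLinearMap.id ℝ V + φ.smulRight w
  have hlin : ∀ l, (b.coord l).linear w = b.coord l (b j) - b.coord l (b i) := fun l => by
    have := (b.coord l).linearMap_vsub (b j) (b i)
    simpa only [vsub_eq_sub] using this
  have hφw : φ w = -2 := by
    change (b.coord i).linear w - (b.coord j).linear w = -2
    rw [hlin, hlin, b.coord_apply_ne hij, b.coord_apply_eq, b.coord_apply_eq,
      b.coord_apply_ne hij.symm]
    norm_num
  have hcoord : ∀ l x, b.coord l (f x) = b.coord l x +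
      (b.coord i x - b.coord j x) * (b.coord l (b j) - b.coord l (b i)) := fun l x => by
    have := (b.coord l).map_vadd x ((b.coord i x - b.coord j x) • w)
    rw [map_smul, hlin, vadd_eq_add, vadd_eq_add, smul_eq_mul, add_comm] at this
    rw [add_comm (b.coord l x), ← this]
  have hci : ∀ x, b.coord i (f x) = b.coord j x := fun x => by
    rw [hcoord, b.coord_apply_ne hij, b.coord_apply_eq]; ring
  have hcj : ∀ x, b.coord j (f x) = b.coord i x := fun x => by
    rw [hcoord, b.coord_apply_ne hij.symm, b.coord_apply_eq]; ring
  have hff : ∀ x, f (f x) = x := fun x => by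
    change f x + (b.coord i (f x) - b.coord j (f x)) • w = x
    rw [hci, hcj]
    change x + (b.coord i x - b.coord j x) • w + _ = x
    module
  have hfS : MapsTo f S S := by
    intro x hx
    rw [show S = _ from b.convexHull_eq_nonneg_coord, mem_ofPred_eq] at hx ⊢
    intro l
    by_cases h1 : l = i
    · rw [h1, hci]; exact hx j
    by_cases h2 : l = j
    · rw [h2, hcj]; exact hx i
    rw [hcoord, b.coord_apply_ne h1, b.coord_apply_ne h2]
    simpa using hx l
  have himg : f '' S = S :=
    (hfS.image_subset).antisymm fun x hx => ⟨f x, hfS hx, hff x⟩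
  have hdet : |L.det| = 1 := by
    have hLL : L.comp L = ContinuousLinearMap.id ℝ V := by
      ext v
      simp only [L, ContinuousLinearMap.comp_apply, add_apply,
        ContinuousLinearMap.id_apply, ContinuousLinearMap.smulRight_apply, map_add, map_smul, hφw]
      module
    have h1 : L.det * L.det = 1 := by
      have h2 : LinearMap.det ((L : V →ₗ[ℝ] V) ∘ₗ (L : V →ₗ[ℝ] V)) = 1 := by
        rw [← ContinuousLinearMap.toLinearMap_comp, hLL]
        exact LinearMap.det_id
      rwa [LinearMap.det_comp] at h2
    rcases mul_self_eq_one_iff.1 h1 with h | h <;> rw [h] <;> simp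
  have hder : ∀ x ∈ S, HasFDerivWithinAt f L S x := by
    intro x _
    have e : f = fun y => y + (φ y + (b.coord i 0 - b.coord j 0)) • w := by
      funext y
      have d : ∀ l, b.coord l y = (b.coord l).linear y + b.coord l 0 := fun l =>
        congrFun (b.coord l).decomp y
      simp only [f, φ, d i, d j]
      congr 2
      simp only [LinearMap.coe_toContinuousLinearMap', LinearMap.sub_apply]
      ring
    rw [e]
    exact ((hasFDerivAt_id x).add ((φ.hasFDerivAt.add_const _).smul_const w)).hasFDerivWithinAt
  have key := integral_image_eq_integral_abs_det_fderiv_smul μ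
    (isCompact_convexHull_range b).measurableSet hder
    (fun x _ y _ h => by rw [← hff x, h, hff y]) (fun x => b.coord i x)
  rw [himg] at key
  rw [key]
  simp only [hdet, one_smul, hci, S]

theorem integral_coord (b : AffineBasis J ℝ V) (i : J) :
    ∫ x in convexHull ℝ (range b), b.coord i x ∂μ =
      μ.real (convexHull ℝ (range b)) / Fintype.card J := by
  have h1 : ∑ j, ∫ x in convexHull ℝ (range b), b.coord j x ∂μ =
      μ.real (convexHull ℝ (range b)) := by
    rw [← integral_finsetSum _ fun j _ => integrableOn_convexHull b μ
      (AffineMap.continuous_of_finiteDimensional _)]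
    simp [b.sum_coord_apply_eq_one]
  have hJ : (Fintype.card J : ℝ) ≠ 0 := Nat.cast_ne_zero.2 (Fintype.card_pos_iff.2 ⟨i⟩).ne'
  rw [eq_div_iff hJ, ← h1,
    Finset.sum_congr rfl fun j _ => integral_coord_eq_integral_coord μ b j i]
  simp [mul_comm]

/-- The vertex quadrature is exact on affine functions. -/
theorem integral_affine (b : AffineBasis J ℝ V) (f : V →ᵃ[ℝ] ℝ) :
    ∫ x in convexHull ℝ (range b), f x ∂μ =
      μ.real (convexHull ℝ (range b)) / Fintype.card J * ∑ i, f (b i) := by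
  have hf : ∀ x, f x = ∑ i, b.coord i x * f (b i) := apply_eq_sum_coord b f
  rw [setIntegral_congr_fun (isCompact_convexHull_range b).measurableSet fun x _ => hf x]
  have hint : ∀ i ∈ Finset.univ, IntegrableOn (fun x => b.coord i x * f (b i))
      (convexHull ℝ (range b)) μ := fun i _ => integrableOn_convexHull b μ
    ((AffineMap.continuous_of_finiteDimensional _).mul continuous_const)
  rw [integral_finsetSum _ hint]
  simp_rw [integral_mul_const, integral_coord, ← Finset.mul_sum]

/-- The vertex quadrature overestimates the integral of the convex function `‖p‖²`. -/
theorem integral_norm_sq_le (b : AffineBasis J ℝ V) (p : V →ᵃ[ℝ] F) (hp : Continuous p) :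
    ∫ x in convexHull ℝ (range b), ‖p x‖ ^ 2 ∂μ ≤
      μ.real (convexHull ℝ (range b)) / Fintype.card J * ∑ i, ‖p (b i)‖ ^ 2 := by
  have hc : ∀ i, Continuous (b.coord i) := fun i => AffineMap.continuous_of_finiteDimensional _
  have hint : ∀ i ∈ Finset.univ, IntegrableOn (fun x => b.coord i x * ‖p (b i)‖ ^ 2)
      (convexHull ℝ (range b)) μ := fun i _ =>
    integrableOn_convexHull b μ ((hc i).mul continuous_const)
  calc ∫ x in convexHull ℝ (range b), ‖p x‖ ^ 2 ∂μ
      ≤ ∫ x in convexHull ℝ (range b), ∑ i, b.coord i x * ‖p (b i)‖ ^ 2 ∂μ := by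
        refine setIntegral_mono_on (integrableOn_convexHull b μ (hp.norm.pow 2))
          (integrable_finsetSum _ hint) (isCompact_convexHull_range b).measurableSet fun x hx => ?_
        rw [b.convexHull_eq_nonneg_coord, mem_ofPred_eq] at hx
        have hcv : ConvexOn ℝ univ fun y : F => ‖y‖ ^ 2 :=
          (convexOn_norm convex_univ).pow (fun _ _ => norm_nonneg _) 2
        have := hcv.map_sum_le (t := Finset.univ) (w := fun i => b.coord i x)
          (p := fun i => p (b i)) (fun i _ => hx i) (b.sum_coord_apply_eq_one x) (by simp)
        rwa [← apply_eq_sum_coord b p x] at this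
    _ = _ := by
        rw [integral_finsetSum _ hint]
        simp_rw [integral_mul_const, integral_coord, ← Finset.mul_sum]

/-- The value of an affine map at a vertex is controlled by its mean square. With
`y = (x + b i) / 2` one has `p (b i) = 2 p y - p x`, and `y` runs through a homothetic copy of the
simplex inside the simplex as `x` runs through the simplex. -/
theorem norm_sq_apply_vertex_le (b : AffineBasis J ℝ V) (p : V →ᵃ[ℝ] F) (hp : Continuous p)
    (i : J) : μ.real (convexHull ℝ (range b)) * ‖p (b i)‖ ^ 2 ≤
      (8 * 2 ^ Module.finrank ℝ V + 2) * ∫ x in convexHull ℝ (range b), ‖p x‖ ^ 2 ∂μ := by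
  set S := convexHull ℝ (range b)
  have hSm : MeasurableSet S := (isCompact_convexHull_range b).measurableSet
  let f : V → V := fun x => (2⁻¹ : ℝ) • x + (2⁻¹ : ℝ) • b i
  have hfc : Continuous f := (continuous_const_smul _).add continuous_const
  have hpf : ∀ x, p (f x) = (2⁻¹ : ℝ) • p x + (2⁻¹ : ℝ) • p (b i) := fun x =>
    Convex.combo_affine_apply (by norm_num)
  have hI : ∀ g : V → F, Continuous g → IntegrableOn (fun x => ‖g x‖ ^ 2) S μ := fun g hg =>
    integrableOn_convexHull b μ (hg.norm.pow 2)
  have hder : ∀ x ∈ S, HasFDerivWithinAt f ((2⁻¹ : ℝ) • ContinuousLinearMap.id ℝ V) S x := fun x _ =>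
    (((hasFDerivAt_id x).const_smul (2⁻¹ : ℝ)).add_const _).hasFDerivWithinAt
  have hinj : InjOn f S := fun x _ y _ h =>
    smul_right_injective V (by norm_num : (2⁻¹ : ℝ) ≠ 0) (add_right_cancel h)
  have hdet : |((2⁻¹ : ℝ) • ContinuousLinearMap.id ℝ V).det| = (2 ^ Module.finrank ℝ V)⁻¹ := by
    have : ((2⁻¹ : ℝ) • ContinuousLinearMap.id ℝ V).det = (2⁻¹ : ℝ) ^ Module.finrank ℝ V := by
      change LinearMap.det ((2⁻¹ : ℝ) • LinearMap.id) = _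
      simp
    rw [this, abs_of_pos (by positivity), inv_pow]
  have hchange := integral_image_eq_integral_abs_det_fderiv_smul μ hSm hder hinj
    (fun x => ‖p x‖ ^ 2)
  simp only [hdet, smul_eq_mul, integral_const_mul] at hchange
  have hsub : f '' S ⊆ S := by
    rintro _ ⟨x, hx, rfl⟩
    exact convex_convexHull ℝ _ hx (subset_convexHull ℝ _ (mem_range_self i)) (by norm_num)
      (by norm_num) (by norm_num)
  have h2 : ∫ x in S, ‖p (f x)‖ ^ 2 ∂μ ≤ 2 ^ Module.finrank ℝ V * ∫ x in S, ‖p x‖ ^ 2 ∂μ := by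
    have h3 : ∫ x in f '' S, ‖p x‖ ^ 2 ∂μ ≤ ∫ x in S, ‖p x‖ ^ 2 ∂μ :=
      setIntegral_mono_set (hI p hp) (Eventually.of_forall fun x => by positivity)
        (Eventually.of_forall hsub)
    rw [hchange] at h3
    rwa [inv_mul_le_iff₀ (by positivity)] at h3
  calc μ.real S * ‖p (b i)‖ ^ 2 = ∫ x in S, ‖p (b i)‖ ^ 2 ∂μ := by simp
    _ ≤ ∫ x in S, (8 * ‖p (f x)‖ ^ 2 + 2 * ‖p x‖ ^ 2) ∂μ := by
        refine setIntegral_mono_on (hI (fun _ => p (b i)) continuous_const)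
          (((hI _ (hp.comp hfc)).const_mul 8).add ((hI p hp).const_mul 2)) hSm fun x _ => ?_
        have e : p (b i) = (2 : ℝ) • p (f x) - p x := by rw [hpf]; module
        have h4 : ‖p (b i)‖ ≤ 2 * ‖p (f x)‖ + ‖p x‖ := by
          rw [e]
          refine (norm_sub_le _ _).trans ?_
          rw [norm_smul]; norm_num
        have h5 := norm_nonneg (p (b i))
        change ‖p (b i)‖ ^ 2 ≤ 8 * ‖p (f x)‖ ^ 2 + 2 * ‖p x‖ ^ 2
        nlinarith [sq_nonneg (2 * ‖p (f x)‖ - ‖p x‖)]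
    _ = 8 * ∫ x in S, ‖p (f x)‖ ^ 2 ∂μ + 2 * ∫ x in S, ‖p x‖ ^ 2 ∂μ := by
        have := integral_add ((hI _ (hp.comp hfc)).const_mul 8) ((hI p hp).const_mul 2)
        simpa only [integral_const_mul, Function.comp_apply] using this
    _ ≤ _ := by nlinarith

end Simplex

/-! ### Geometry of a mesh -/

section Mesh

variable {n : ℕ} {Ω : Set (E n)}

theorem IsPolyhedralDomain.volume_frontier (hΩ : IsPolyhedralDomain Ω) :
    volume (frontier Ω) = 0 := by
  obtain ⟨S, hS, hsub⟩ := hΩ.boundary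
  refine measure_mono_null hsub ((measure_biUnion_null_iff S.countable_toSet).2 fun A hA => ?_)
  exact Measure.addHaar_affineSubspace volume A (hS A hA)

theorem IsPolyhedralDomain.closure_ae_eq (hΩ : IsPolyhedralDomain Ω) :
    closure Ω =ᵐ[volume] Ω := by
  rw [closure_eq_self_union_frontier]
  exact union_ae_eq_left_of_ae_eq_empty (ae_eq_empty.2 hΩ.volume_frontier)

variable {M : SimplicialMesh Ω} {T : Finset (E n)}

theorem SimplicialMesh.mem_cells : T ∈ M.cells ↔ T ∈ M.complex.faces ∧ T.card = n + 1 := by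
  simp [SimplicialMesh.cells]

/-- The vertices of a cell as an affine basis of `ℝⁿ`. -/
def SimplicialMesh.cellBasis (hT : T ∈ M.cells) : AffineBasis T ℝ (E n) where
  toFun := fun x => x
  ind' := M.complex.indep (SimplicialMesh.mem_cells.1 hT).1
  tot' := by
    rw [(M.complex.indep (SimplicialMesh.mem_cells.1 hT).1
      ).affineSpan_eq_top_iff_card_eq_finrank_add_one, Fintype.card_coe,
      (SimplicialMesh.mem_cells.1 hT).2, finrank_euclideanSpace_fin]

theorem SimplicialMesh.cellBasis_apply (hT : T ∈ M.cells) (x : T) :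
    SimplicialMesh.cellBasis hT x = x := rfl

theorem SimplicialMesh.range_cellBasis (hT : T ∈ M.cells) :
    range (SimplicialMesh.cellBasis hT) = T :=
  Subtype.range_coe

theorem isCompact_simplex (T : Finset (E n)) : IsCompact (simplex T) :=
  T.finite_toSet.isCompact_convexHull ℝ

theorem measurableSet_simplex (T : Finset (E n)) : MeasurableSet (simplex T) :=
  (isCompact_simplex T).measurableSet

theorem SimplicialMesh.affineSpan_cell (hT : T ∈ M.cells) :
    affineSpan ℝ (T : Set (E n)) = ⊤ := by
  rw [← SimplicialMesh.range_cellBasis hT]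
  exact (SimplicialMesh.cellBasis hT).tot

theorem SimplicialMesh.simplex_subset (hT : T ∈ M.cells) : simplex T ⊆ closure Ω := by
  rw [← M.space_eq]
  exact M.complex.convexHull_subset_space (SimplicialMesh.mem_cells.1 hT).1

theorem SimplicialMesh.interior_inter_nonempty (hT : T ∈ M.cells) :
    (interior (simplex T) ∩ Ω).Nonempty := by
  obtain ⟨x, hx⟩ := interior_convexHull_nonempty_iff_affineSpan_eq_top.2
    (SimplicialMesh.affineSpan_cell hT)
  exact mem_closure_iff.1 (SimplicialMesh.simplex_subset hT (interior_subset hx)) _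
    isOpen_interior hx

theorem SimplicialMesh.iUnion_cells (M : SimplicialMesh Ω) :
    ⋃ T : M.cells, simplex (T : Finset (E n)) = closure Ω := by
  refine Subset.antisymm (iUnion_subset fun T => SimplicialMesh.simplex_subset T.2) ?_
  rw [← M.space_eq]
  intro x hx
  obtain ⟨s, hs, hxs⟩ := Geometry.SimplicialComplex.mem_space_iff.1 hx
  obtain ⟨T, hT, hsT, hc⟩ := M.pure s hs
  exact mem_iUnion.2 ⟨⟨T, SimplicialMesh.mem_cells.2 ⟨hT, hc⟩⟩,
    convexHull_mono (Finset.coe_subset.2 hsT) hxs⟩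

theorem SimplicialMesh.aedisjoint {T' : Finset (E n)} (hT : T ∈ M.cells) (hT' : T' ∈ M.cells)
    (hne : T ≠ T') : AEDisjoint volume (simplex T) (simplex T') := by
  classical
  have h1 := SimplicialMesh.mem_cells.1 hT
  have h2 := SimplicialMesh.mem_cells.1 hT'
  have hss : T ∩ T' ⊂ T := by
    refine Finset.inter_subset_left.ssubset_of_ne fun h => hne ?_
    exact Finset.eq_of_subset_of_card_le (Finset.inter_eq_left.1 h) (by rw [h1.2, h2.2])
  have hcard : (T ∩ T').card < n + 1 := by
    rw [← h1.2]
    exact Finset.card_lt_card hss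
  have hne_top : affineSpan ℝ ((T ∩ T' : Finset (E n)) : Set (E n)) ≠ ⊤ := by
    intro htop
    have hind : AffineIndependent ℝ ((↑) : (T ∩ T' : Finset (E n)) → E n) :=
      (M.complex.indep h1.1).mono (Finset.coe_subset.2 Finset.inter_subset_left)
    have := hind.affineSpan_eq_top_iff_card_eq_finrank_add_one.1 (by
      rw [← htop]; congr 1; exact Subtype.range_coe)
    rw [Fintype.card_coe, finrank_euclideanSpace_fin] at this
    omega
  refine measure_mono_null ?_ (Measure.addHaar_affineSubspace volume _ hne_top)
  refine (M.complex.inter_subset_convexHull h1.1 h2.1).trans ?_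
  rw [← Finset.coe_inter]
  exact convexHull_subset_affineSpan _

theorem IsPolyhedralDomain.restrict_simplex_le (hΩ : IsPolyhedralDomain Ω) (hT : T ∈ M.cells) :
    volume.restrict (simplex T) ≤ volume.restrict Ω := by
  rw [← Measure.restrict_congr_set hΩ.closure_ae_eq]
  exact Measure.restrict_mono (SimplicialMesh.simplex_subset hT) le_rfl

theorem IsPolyhedralDomain.setIntegral_eq_sum (hΩ : IsPolyhedralDomain Ω) (M : SimplicialMesh Ω)
    {f : E n → ℝ} (hf : Integrable f (volume.restrict Ω)) :
    ∫ x in Ω, f x = ∑ T ∈ M.cells, ∫ x in simplex T, f x := by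
  rw [← Measure.restrict_congr_set hΩ.closure_ae_eq] at hf ⊢
  rw [← M.iUnion_cells] at hf ⊢
  rw [integral_iUnion_ae (fun T => (measurableSet_simplex _).nullMeasurableSet)
    (fun T T' h => SimplicialMesh.aedisjoint T.2 T'.2 fun h' => h (Subtype.ext h')) hf,
    tsum_fintype]
  exact Finset.sum_coe_sort M.cells fun T => ∫ x in simplex T, f x

/-! ### Local polynomial forms and the vertex quadrature -/

variable {k : ℕ}

theorem P1Form.continuous (p : P1Form n k) : Continuous p :=
  AffineMap.continuous_of_finiteDimensional p

theorem IsPolyhedralDomain.agreesOn_unique (hΩ : IsPolyhedralDomain Ω) (hT : T ∈ M.cells)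
    {u : L2Form Ω k} {p q : P1Form n k} (hp : AgreesOn u T p) (hq : AgreesOn u T q) : p = q := by
  have hU : IsOpen (interior (simplex T) ∩ Ω) := isOpen_interior.inter hΩ.isOpen
  have hae : p =ᵐ[volume.restrict (interior (simplex T) ∩ Ω)] q := by
    have h1 := ae_restrict_of_ae_restrict_of_subset (inter_subset_right (s := interior (simplex T)))
      (hp.and hq)
    filter_upwards [h1, ae_restrict_mem hU.measurableSet] with x hx hxU
    rw [← hx.1 (interior_subset hxU.1), hx.2 (interior_subset hxU.1)]
  exact AffineMap.ext_on (hU.affineSpan_eq_top (SimplicialMesh.interior_inter_nonempty hT))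
    (Measure.eqOn_open_of_ae_eq hae hU p.continuous.continuousOn q.continuous.continuousOn)

theorem IsPolyhedralDomain.localForm_eq (hΩ : IsPolyhedralDomain Ω) (hT : T ∈ M.cells)
    {u : L2Form Ω k} {p : P1Form n k} (hp : AgreesOn u T p) : localForm u T = p := by
  have h : ∃ p : P1Form n k, AgreesOn u T p := ⟨p, hp⟩
  rw [localForm, dif_pos h]
  exact hΩ.agreesOn_unique hT h.choose_spec hp

theorem agreesOn_localForm {u : L2Form Ω k} {S : Submodule ℝ (P1Form n k)}
    (hu : u ∈ brokenForms M S) (hT : T ∈ M.cells) : AgreesOn u T (localForm u T) := by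
  obtain ⟨p, -, hp⟩ := hu T hT
  have h : ∃ p : P1Form n k, AgreesOn u T p := ⟨p, hp⟩
  rw [localForm, dif_pos h]
  exact h.choose_spec

theorem brokenForms_le_top (M : SimplicialMesh Ω) (S : Submodule ℝ (P1Form n k)) :
    brokenForms M S ≤ brokenForms M ⊤ := fun _ hu T hT =>
  (hu T hT).imp fun _ hp => ⟨Submodule.mem_top, hp.2⟩

theorem IsPolyhedralDomain.localForm_add (hΩ : IsPolyhedralDomain Ω) (hT : T ∈ M.cells)
    {u v : L2Form Ω k} (hu : u ∈ brokenForms M ⊤) (hv : v ∈ brokenForms M ⊤) :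
    localForm (u + v) T = localForm u T + localForm v T := by
  refine hΩ.localForm_eq hT ?_
  filter_upwards [Lp.coeFn_add u v, agreesOn_localForm hu hT, agreesOn_localForm hv hT]
    with x h1 h2 h3 hx
  rw [h1, Pi.add_apply, h2 hx, h3 hx]
  rfl

theorem IsPolyhedralDomain.localForm_smul (hΩ : IsPolyhedralDomain Ω) (hT : T ∈ M.cells)
    (c : ℝ) {u : L2Form Ω k} (hu : u ∈ brokenForms M ⊤) :
    localForm (c • u) T = c • localForm u T := by
  refine hΩ.localForm_eq hT ?_
  filter_upwards [Lp.coeFn_smul c u, agreesOn_localForm hu hT] with x h1 h2 hx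
  rw [h1, Pi.smul_apply, h2 hx]
  rfl

theorem IsPolyhedralDomain.ae_eq_localForm (hΩ : IsPolyhedralDomain Ω) (hT : T ∈ M.cells)
    {u : L2Form Ω k} (hu : u ∈ brokenForms M ⊤) :
    ∀ᵐ x ∂(volume.restrict (simplex T)), u x = localForm u T x := by
  filter_upwards [ae_mono (hΩ.restrict_simplex_le hT) (agreesOn_localForm hu hT),
    ae_restrict_mem (measurableSet_simplex T)] with x hx hxT
  exact hx hxT

theorem IsPolyhedralDomain.inner_eq_sum (hΩ : IsPolyhedralDomain Ω) {u v : L2Form Ω k}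
    (hu : u ∈ brokenForms M ⊤) (hv : v ∈ brokenForms M ⊤) :
    ⟪u, v⟫_ℝ = ∑ T ∈ M.cells, ∫ x in simplex T, ⟪localForm u T x, localForm v T x⟫_ℝ := by
  rw [L2.inner_def, hΩ.setIntegral_eq_sum M (L2.integrable_inner u v)]
  refine Finset.sum_congr rfl fun T hT => integral_congr_ae ?_
  filter_upwards [hΩ.ae_eq_localForm hT hu, hΩ.ae_eq_localForm hT hv] with x h1 h2
  rw [h1, h2]

/-- A broken form is determined by the vertex values of its restrictions to the cells. -/
theorem IsPolyhedralDomain.finiteDimensional_brokenForms (hΩ : IsPolyhedralDomain Ω)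
    (M : SimplicialMesh Ω) : FiniteDimensional ℝ (brokenForms M (⊤ : Submodule ℝ (P1Form n k))) := by
  let vals : brokenForms M (⊤ : Submodule ℝ (P1Form n k)) →ₗ[ℝ]
      ((T : M.cells) → T.1 → Alt n k) :=
    { toFun := fun u T x => localForm (u : L2Form Ω k) T.1 x
      map_add' := fun u v => by
        funext T x
        change localForm ((u : L2Form Ω k) + (v : L2Form Ω k)) T.1 x = _
        rw [hΩ.localForm_add T.2 u.2 v.2]
        rfl
      map_smul' := fun c u => by
        funext T x
        change localForm (c • (u : L2Form Ω k)) T.1 x = _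
        rw [hΩ.localForm_smul T.2 c u.2]
        rfl }
  refine FiniteDimensional.of_injective vals ((injective_iff_map_eq_zero vals).2 fun u hu => ?_)
  have h0 : ∀ T ∈ M.cells, localForm (u : L2Form Ω k) T = 0 := fun T hT =>
    AffineMap.ext_on (SimplicialMesh.affineSpan_cell hT) fun x hx =>
      congrFun (congrFun hu ⟨T, hT⟩) ⟨x, hx⟩
  refine Subtype.ext (inner_self_eq_zero (𝕜 := ℝ).1 ?_)
  rw [hΩ.inner_eq_sum u.2 u.2]
  refine Finset.sum_eq_zero fun T hT => ?_
  simp [h0 T hT]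

theorem IsPolyhedralDomain.finiteDimensional_of_le (hΩ : IsPolyhedralDomain Ω)
    {S : Submodule ℝ (P1Form n k)} {V : Submodule ℝ (L2Form Ω k)} (hV : V ≤ brokenForms M S) :
    FiniteDimensional ℝ V :=
  haveI := hΩ.finiteDimensional_brokenForms (k := k) M
  Submodule.finiteDimensional_of_le (hV.trans (brokenForms_le_top M S))

theorem quadForm_comm (M : SimplicialMesh Ω) (u v : L2Form Ω k) :
    quadForm M u v = quadForm M v u := by
  simp only [quadForm, quadCell, real_inner_comm]

theorem IsPolyhedralDomain.quadForm_add_left (hΩ : IsPolyhedralDomain Ω) {u v : L2Form Ω k}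
    (hu : u ∈ brokenForms M ⊤) (hv : v ∈ brokenForms M ⊤) (w : L2Form Ω k) :
    quadForm M (u + v) w = quadForm M u w + quadForm M v w := by
  rw [quadForm, quadForm, quadForm, ← Finset.sum_add_distrib]
  refine Finset.sum_congr rfl fun T hT => ?_
  simp only [quadCell, hΩ.localForm_add hT hu hv, AffineMap.coe_add, Pi.add_apply, inner_add_left,
    Finset.sum_add_distrib, mul_add]

theorem IsPolyhedralDomain.quadForm_smul_left (hΩ : IsPolyhedralDomain Ω) (c : ℝ)
    {u : L2Form Ω k} (hu : u ∈ brokenForms M ⊤) (w : L2Form Ω k) :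
    quadForm M (c • u) w = c * quadForm M u w := by
  rw [quadForm, quadForm, Finset.mul_sum]
  refine Finset.sum_congr rfl fun T hT => ?_
  simp only [quadCell, hΩ.localForm_smul hT c hu, AffineMap.coe_smul, Pi.smul_apply,
    real_inner_smul_left, ← Finset.mul_sum]
  ring

theorem quadForm_self_nonneg (M : SimplicialMesh Ω) (u : L2Form Ω k) : 0 ≤ quadForm M u u :=
  Finset.sum_nonneg fun _ _ => mul_nonneg (by positivity)
    (Finset.sum_nonneg fun _ _ => real_inner_self_nonneg)

theorem card_cell (hT : T ∈ M.cells) : (Fintype.card T : ℝ) = n + 1 := by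
  rw [Fintype.card_coe, (SimplicialMesh.mem_cells.1 hT).2]
  push_cast
  rfl

theorem IsPolyhedralDomain.norm_sq_le_quadForm (hΩ : IsPolyhedralDomain Ω) {u : L2Form Ω k}
    (hu : u ∈ brokenForms M ⊤) : ‖u‖ ^ 2 ≤ quadForm M u u := by
  rw [← real_inner_self_eq_norm_sq, hΩ.inner_eq_sum hu hu]
  refine Finset.sum_le_sum fun T hT => ?_
  have h := integral_norm_sq_le volume (SimplicialMesh.cellBasis hT) (localForm u T)
    (localForm u T).continuous
  rw [SimplicialMesh.range_cellBasis, card_cell hT] at h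
  simp only [SimplicialMesh.cellBasis_apply] at h
  rw [Finset.sum_coe_sort T fun x => ‖localForm u T x‖ ^ 2] at h
  simpa only [quadCell, real_inner_self_eq_norm_sq] using h

theorem IsPolyhedralDomain.quadForm_le_norm_sq (hΩ : IsPolyhedralDomain Ω) {u : L2Form Ω k}
    (hu : u ∈ brokenForms M ⊤) : quadForm M u u ≤ (8 * 2 ^ n + 2) * ‖u‖ ^ 2 := by
  rw [← real_inner_self_eq_norm_sq, hΩ.inner_eq_sum hu hu, Finset.mul_sum]
  refine Finset.sum_le_sum fun T hT => ?_
  simp only [quadCell, real_inner_self_eq_norm_sq]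
  rw [div_mul_eq_mul_div, div_le_iff₀ (by positivity), Finset.mul_sum]
  have h : ∀ x ∈ T, volume.real (simplex T) * ‖localForm u T x‖ ^ 2 ≤
      (8 * 2 ^ n + 2) * ∫ y in simplex T, ‖localForm u T y‖ ^ 2 := fun x hx => by
    have h := norm_sq_apply_vertex_le volume (SimplicialMesh.cellBasis hT) (localForm u T)
      (localForm u T).continuous ⟨x, hx⟩
    rwa [SimplicialMesh.range_cellBasis, SimplicialMesh.cellBasis_apply,
      finrank_euclideanSpace_fin] at h
  refine (Finset.sum_le_card_nsmul _ _ _ h).trans_eq ?_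
  rw [(SimplicialMesh.mem_cells.1 hT).2, nsmul_eq_mul]
  push_cast
  ring

theorem IsPolyhedralDomain.quadForm_sq_le (hΩ : IsPolyhedralDomain Ω) {u v : L2Form Ω k}
    (hu : u ∈ brokenForms M ⊤) (hv : v ∈ brokenForms M ⊤) :
    quadForm M u v ^ 2 ≤ quadForm M u u * quadForm M v v := by
  let B : LinearMap.BilinForm ℝ (brokenForms M (⊤ : Submodule ℝ (P1Form n k))) :=
    LinearMap.mk₂ ℝ (fun u v => quadForm M (u : L2Form Ω k) v)
      (fun u v w => hΩ.quadForm_add_left u.2 v.2 w)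
      (fun c u w => hΩ.quadForm_smul_left c u.2 w)
      (fun u v w => by
        rw [quadForm_comm M, quadForm_comm M (u : L2Form Ω k), quadForm_comm M (u : L2Form Ω k)]
        exact hΩ.quadForm_add_left v.2 w.2 u)
      (fun c u w => by
        rw [quadForm_comm M, quadForm_comm M (u : L2Form Ω k)]
        exact hΩ.quadForm_smul_left c w.2 u)
  exact B.apply_sq_le_of_symm (fun u => quadForm_self_nonneg M _)
    ⟨fun u v => quadForm_comm M _ _⟩ ⟨u, hu⟩ ⟨v, hv⟩

/-- Against a piecewise constant form the vertex quadrature is exact. -/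
theorem IsPolyhedralDomain.inner_eq_quadForm (hΩ : IsPolyhedralDomain Ω) {u v : L2Form Ω k}
    (hu : u ∈ brokenForms M ⊤) (hv : v ∈ P0Space M k) : ⟪u, v⟫_ℝ = quadForm M u v := by
  rw [hΩ.inner_eq_sum hu (brokenForms_le_top M _ hv)]
  refine Finset.sum_congr rfl fun T hT => ?_
  obtain ⟨q, ⟨a, ha⟩, hq⟩ := hv T hT
  let f : E n →ᵃ[ℝ] ℝ := (innerₗ (Alt n k) a).toAffineMap.comp (localForm u T)
  have h := integral_affine volume (SimplicialMesh.cellBasis hT) f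
  rw [SimplicialMesh.range_cellBasis, card_cell hT] at h
  simp only [SimplicialMesh.cellBasis_apply] at h
  rw [Finset.sum_coe_sort T fun x => f x] at h
  simp only [quadCell, hΩ.localForm_eq hT hq, ha]
  simp only [real_inner_comm a]
  exact h

end Mesh

/-! ### The exterior derivative of piecewise affine forms -/

section ExteriorDerivative

variable {n k : ℕ} {Ω : Set (E n)}

theorem mem_graph_extD (hΩ : IsOpen Ω) {p : L2Form Ω k × L2Form Ω (k + 1)} :
    p ∈ (extD Ω k).graph ↔ IsWeakExtDeriv Ω p.1 p.2 := by
  rw [extD, Submodule.toLinearPMap_graph_eq _ (extDerivGraph_functional hΩ k)]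
  rfl

theorem isWeakExtDeriv_extD (hΩ : IsOpen Ω) (u : (extD Ω k).domain) :
    IsWeakExtDeriv Ω (u : L2Form Ω k) (extD Ω k u) :=
  (mem_graph_extD hΩ).1 ((extD Ω k).mem_graph u)

/-- Weakly, `d ∘ d = 0`: testing with the derivatives of `φ` leaves the pairing of the alternating
form `u` with the symmetric second derivative of `φ`. -/
theorem IsWeakExtDeriv.isWeakExtDeriv_zero {u : L2Form Ω k} {w : L2Form Ω (k + 1)}
    (h : IsWeakExtDeriv Ω u w) : IsWeakExtDeriv Ω w (0 : L2Form Ω (k + 2)) := by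
  intro φ hφ hc hs t
  have hz : ∫ x in Ω, ((0 : L2Form Ω (k + 2)) x) t * φ x = 0 := by
    refine integral_eq_zero_of_ae ?_
    have h0 : ∀ᵐ x ∂(volume.restrict Ω), (0 : L2Form Ω (k + 2)) x = 0 := Lp.coeFn_zero _ _ _
    filter_upwards [h0] with x hx
    simp only [hx, AlternatingMap.zero_apply, zero_mul, Pi.zero_apply]
  rw [hz, neg_zero]
  have hφ' : ∀ v : E n, ContDiff ℝ ∞ fun x => fderiv ℝ φ x v := fun v =>
    (hφ.fderiv_right (by simp)).clm_apply contDiff_const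
  have hc' : ∀ v : E n, HasCompactSupport fun x => fderiv ℝ φ x v := fun v => hc.fderiv_apply ℝ v
  have hs' : ∀ v : E n, tsupport (fun x => fderiv ℝ φ x v) ⊆ Ω := fun v =>
    (tsupport_fderiv_apply_subset ℝ v).trans hs
  have hstep : ∀ j : Fin (k + 2), ∫ x in Ω, w x (j.removeNth t) * fderiv ℝ φ x (t j) =
      -∑ i : Fin (k + 1), (-1 : ℝ) ^ (i : ℕ) * ∫ x in Ω, u x (i.removeNth (j.removeNth t)) *
        fderiv ℝ (fun y => fderiv ℝ φ y (t j)) x (j.removeNth t i) := fun j => by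
    rw [h _ (hφ' _) (hc' _) (hs' _) (j.removeNth t), neg_neg]
  simp_rw [hstep]
  have hint : ∀ (j : Fin (k + 2)) (i : Fin (k + 1)), Integrable (fun x =>
      u x (i.removeNth (j.removeNth t)) *
        fderiv ℝ (fun y => fderiv ℝ φ y (t j)) x (j.removeNth t i)) (volume.restrict Ω) :=
    fun j i => integrable_eval_mul u _
      (fderiv_apply_props (hφ' (t j)) (hc' (t j)) _).1
      (fderiv_apply_props (hφ' (t j)) (hc' (t j)) _).2
  have hpt : ∀ x, ∑ j : Fin (k + 2), (-1 : ℝ) ^ (j : ℕ) * ∑ i : Fin (k + 1), (-1 : ℝ) ^ (i : ℕ) *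
      (u x (i.removeNth (j.removeNth t)) *
        fderiv ℝ (fun y => fderiv ℝ φ y (t j)) x (j.removeNth t i)) = 0 := by
    intro x
    have hD : ∀ v v', fderiv ℝ (fun y => fderiv ℝ φ y v) x v' = fderiv ℝ (fderiv ℝ φ) x v' v := by
      intro v v'
      have hd : DifferentiableAt ℝ (fderiv ℝ φ) x :=
        ((hφ.fderiv_right (m := 1) (by norm_cast)).differentiable (by simp)) x
      rw [fderiv_clm_apply hd (differentiableAt_const v)]
      simp
    have hsymm : ∀ v v', fderiv ℝ (fderiv ℝ φ) x v v' = fderiv ℝ (fderiv ℝ φ) x v' v :=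
      fun v v' => (hφ.contDiffAt.isSymmSndFDerivAt (by
          rw [minSmoothness_of_isRCLikeNormedField]
          exact WithTop.coe_le_coe.2 le_top)) v v'
    let f : E n →ₗ[ℝ] E n →ₗ[ℝ] Alt n k := LinearMap.mk₂ ℝ
      (fun v v' => fderiv ℝ (fderiv ℝ φ) x v v' • u x)
      (fun v v' v'' => by simp [add_smul]) (fun c v v' => by simp [mul_smul])
      (fun v v' v'' => by simp [add_smul]) (fun c v v' => by simp [mul_smul])
    have h0 := AlternatingMap.alternatizeUncurryFin_alternatizeUncurryFinLM_comp_of_symmetric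
      (f := f) fun v v' => by simp only [f, LinearMap.mk₂_apply, hsymm v v']
    have h1 := congrArg (fun a : Alt n (k + 2) => a t) h0
    simp only [AlternatingMap.alternatizeUncurryFin_apply, LinearMap.comp_apply,
      AlternatingMap.alternatizeUncurryFinLM_apply, AlternatingMap.zero_apply, f,
      LinearMap.mk₂_apply, AlternatingMap.smul_apply, smul_eq_mul, zsmul_eq_mul, Int.cast_pow,
      Int.cast_neg, Int.cast_one] at h1
    rw [← h1]
    refine Finset.sum_congr rfl fun j _ => ?_
    congr 1
    refine Finset.sum_congr rfl fun i _ => ?_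
    rw [hD, hsymm, mul_comm (u x _)]
  have hI : ∫ x in Ω, ∑ j : Fin (k + 2), (-1 : ℝ) ^ (j : ℕ) * ∑ i : Fin (k + 1),
      (-1 : ℝ) ^ (i : ℕ) * (u x (i.removeNth (j.removeNth t)) *
        fderiv ℝ (fun y => fderiv ℝ φ y (t j)) x (j.removeNth t i)) = 0 := by
    simp only [hpt, integral_zero]
  have hi2 : ∀ j : Fin (k + 2), ∀ i ∈ (Finset.univ : Finset (Fin (k + 1))),
      Integrable (fun x => (-1 : ℝ) ^ (i : ℕ) * (u x (i.removeNth (j.removeNth t)) *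
        fderiv ℝ (fun y => fderiv ℝ φ y (t j)) x (j.removeNth t i))) (volume.restrict Ω) :=
    fun j i _ => (hint j i).const_mul _
  rw [integral_finsetSum _ fun j _ => (integrable_finsetSum _ (hi2 j)).const_mul _] at hI
  simp_rw [integral_const_mul] at hI
  simp_rw [integral_finsetSum _ (hi2 _), integral_const_mul] at hI
  simp only [mul_neg, Finset.sum_neg_distrib, hI, neg_zero]

theorem extD_mem_domain (hΩ : IsOpen Ω) (u : (extD Ω k).domain) :
    extD Ω k u ∈ (extD Ω (k + 1)).domain :=
  LinearPMap.mem_domain_iff.2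
    ⟨0, (mem_graph_extD hΩ).2 (isWeakExtDeriv_extD hΩ u).isWeakExtDeriv_zero⟩

/-- Where `u` is an affine form `p`, the weak exterior derivative of `u` is the constant form `dp`,
the alternatization of the linear part of `p`. -/
theorem IsWeakExtDeriv.ae_eq_of_affine {u : L2Form Ω k} {w : L2Form Ω (k + 1)}
    (h : IsWeakExtDeriv Ω u w) {U : Set (E n)} (hU : IsOpen U) (hUΩ : U ⊆ Ω) {p : P1Form n k}
    (hp : ∀ᵐ x ∂(volume.restrict Ω), x ∈ U → u x = p x) :
    ∀ᵐ x ∂(volume.restrict U), w x = AlternatingMap.alternatizeUncurryFin p.linear := by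
  set a : Alt n (k + 1) := AlternatingMap.alternatizeUncurryFin p.linear
  have key : ∀ t : Fin (k + 1) → E n, ∀ᵐ x, x ∈ U → w x t - a t = 0 := by
    intro t
    have hw : ∀ K ⊆ U, IsCompact K → IntegrableOn (fun x => w x t) K := by
      intro K hK hKc
      have hm : MemLp (fun x => evalAt t (w x)) 2 (volume.restrict Ω) :=
        (evalAt t).comp_memLp' (Lp.memLp w)
      have h1 := hm.mono_measure (Measure.restrict_mono (hK.trans hUΩ) le_rfl)
      have : IsFiniteMeasure (volume.restrict K) := ⟨by simpa using hKc.measure_lt_top⟩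
      exact h1.integrable (by norm_num)
    have hloc : LocallyIntegrableOn (fun x => w x t - a t) U volume := by
      rw [locallyIntegrableOn_iff hU.isLocallyClosed]
      intro K hK hKc
      exact (hw K hK hKc).sub (continuousOn_const.integrableOn_compact hKc)
    refine hU.ae_eq_zero_of_integral_contDiff_smul_eq_zero hloc fun φ hφ hc hs => ?_
    have hz : ∀ x ∉ U, φ x = 0 := fun x hx =>
      image_eq_zero_of_notMem_tsupport fun h => hx (hs h)
    have hz' : ∀ v, ∀ x ∉ U, fderiv ℝ φ x v = 0 := fun v x hx => by
      have := image_eq_zero_of_notMem_tsupport (f := fun x => fderiv ℝ φ x v)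
        fun h => hx (hs (tsupport_fderiv_apply_subset ℝ v h))
      exact this
    have hweak := h φ hφ hc (hs.trans hUΩ) t
    have hpc : ∀ s : Fin k → E n, Continuous fun x => p x s := fun s =>
      (evalAt s).continuous.comp p.continuous
    have hterm : ∀ j : Fin (k + 1), ∫ x in Ω, u x (j.removeNth t) * fderiv ℝ φ x (t j) =
        -∫ x, p.linear (t j) (j.removeNth t) * φ x := by
      intro j
      have e1 : ∫ x in Ω, u x (j.removeNth t) * fderiv ℝ φ x (t j) =
          ∫ x in Ω, p x (j.removeNth t) * fderiv ℝ φ x (t j) := by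
        refine integral_congr_ae ?_
        filter_upwards [hp] with x hx
        by_cases hxU : x ∈ U
        · rw [hx hxU]
        · rw [hz' _ x hxU, mul_zero, mul_zero]
      have hder : ∀ x, HasFDerivAt (fun y => p y (j.removeNth t))
          ((evalAt (j.removeNth t)).comp (LinearMap.toContinuousLinearMap p.linear)) x := by
        intro x
        have e : (fun y => p y (j.removeNth t)) = fun y =>
            (evalAt (j.removeNth t)).comp (LinearMap.toContinuousLinearMap p.linear) y +
              p 0 (j.removeNth t) := by
          funext y
          rw [congrFun p.decomp y]
          rfl
        rw [e]
        exact (ContinuousLinearMap.hasFDerivAt _).add_const _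
      have hfd : ∀ x, fderiv ℝ (fun y => p y (j.removeNth t)) x (t j) =
          p.linear (t j) (j.removeNth t) := fun x => by
        rw [(hder x).fderiv]
        rfl
      obtain ⟨c1, c2⟩ := fderiv_apply_props hφ hc (t j)
      rw [e1, setIntegral_eq_integral_of_forall_compl_eq_zero fun x hx => by
        rw [hz' _ x fun hxU => hx (hUΩ hxU), mul_zero]]
      rw [integral_mul_fderiv_eq_neg_fderiv_mul_of_integrable]
      · simp only [hfd]
      · simp only [hfd]
        exact (hφ.continuous.integrable_of_hasCompactSupport hc).const_mul _
      · exact ((hpc _).mul c1).integrable_of_hasCompactSupport c2.mul_left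
      · exact ((hpc _).mul hφ.continuous).integrable_of_hasCompactSupport hc.mul_left
      · exact fun x _ => (hder x).differentiableAt
      · exact fun x _ => (hφ.differentiable (by simp)) x
    have hwφ : Integrable (fun x => w x t * φ x) := by
      have := integrable_eval_mul w t hφ.continuous hc
      refine (integrableOn_iff_integrable_of_support_subset fun x hx => ?_).1 this
      by_contra hxΩ
      exact hx (by simp [hz x fun hxU => hxΩ (hUΩ hxU)])
    have hφi : Integrable φ := hφ.continuous.integrable_of_hasCompactSupport hc
    have hsum : ∑ j : Fin (k + 1), (-1 : ℝ) ^ (j : ℕ) *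
        ∫ x in Ω, u x (j.removeNth t) * fderiv ℝ φ x (t j) = -(a t * ∫ x, φ x) := by
      simp_rw [hterm, integral_const_mul]
      simp only [a, AlternatingMap.alternatizeUncurryFin_apply, zsmul_eq_mul, Int.cast_pow,
        Int.cast_neg, Int.cast_one, Finset.sum_mul, ← Finset.sum_neg_distrib]
      exact Finset.sum_congr rfl fun j _ => by ring
    rw [hsum, setIntegral_eq_integral_of_forall_compl_eq_zero fun x hx => by
      rw [hz x fun hxU => hx (hUΩ hxU), mul_zero]] at hweak
    have e2 : ∀ x, φ x • (w x t - a t) = w x t * φ x - a t * φ x := fun x => by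
      rw [smul_eq_mul]; ring
    simp_rw [e2]
    rw [integral_sub hwφ (hφi.const_mul _), integral_const_mul]
    linarith
  have hall : ∀ᵐ x, ∀ σ : Fin (k + 1) ↪o Fin n, x ∈ U →
      w x (basisTuple σ) - a (basisTuple σ) = 0 := ae_all_iff.2 fun σ => key _
  rw [ae_restrict_iff' hU.measurableSet]
  filter_upwards [hall] with x hx hxU
  exact sub_eq_zero.1 (eq_zero_of_basisTuple _ fun σ => hx σ hxU)

theorem mem_whitneyForms_const (a : Alt n k) :
    AffineMap.const ℝ (E n) a ∈ whitneyForms n k :=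
  ⟨a, 0, fun x => by ext t; simp⟩

/-- `d` maps piecewise affine forms to piecewise constant forms; these are Whitney forms. -/
theorem extD_mem_P1MinusSpace (hΩ : IsPolyhedralDomain Ω) (M : SimplicialMesh Ω)
    (u : (extD Ω k).domain) (hu : (u : L2Form Ω k) ∈ P1Space M k) :
    extD Ω k u ∈ P1MinusSpace M (k + 1) := by
  refine ⟨extD_mem_domain hΩ.isOpen u, fun T hT => ?_⟩
  obtain ⟨p, -, hp⟩ := hu.2 T hT
  refine ⟨_, mem_whitneyForms_const (AlternatingMap.alternatizeUncurryFin p.linear), ?_⟩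
  have hU : IsOpen (interior (simplex T) ∩ Ω) := isOpen_interior.inter hΩ.isOpen
  have h1 := (isWeakExtDeriv_extD hΩ.isOpen u).ae_eq_of_affine hU inter_subset_right
    (hp.mono fun x hx hxU => hx (interior_subset hxU.1))
  rw [ae_restrict_iff' hU.measurableSet] at h1
  have h2 : ∀ᵐ x, x ∉ frontier (simplex T) :=
    measure_eq_zero_iff_ae_notMem.1 ((convex_convexHull ℝ _).addHaar_frontier volume)
  rw [AgreesOn, ae_restrict_iff' hΩ.isOpen.measurableSet]
  filter_upwards [h1, h2] with x hx1 hx2 hxΩ hxT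
  refine hx1 ⟨?_, hxΩ⟩
  by_contra hi
  exact hx2 ⟨subset_closure hxT, hi⟩

end ExteriorDerivative

end FEEC

end

open FEEC
theorem theorem4p1 (n k : ℕ) (hk : k + 1 ≤ n) (Ω : Set (E n)) (hΩ : IsPolyhedralDomain Ω)
    {ι : Type*} (M : ι → SimplicialMesh Ω) (hM : ShapeRegular M) :
    (∀ i, IsDiscreteSegment (extD Ω k) (extD Ω (k + 1))
      (P1Space (M i) k) (P1MinusSpace (M i) (k + 1))) ∧
    StabilityCondition (fun i => P1Space (M i) k) (fun i => quadForm (M i)) ∧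
    ConsistencyCondition (extD Ω k) (fun i => P1Space (M i) k) (fun i => quadForm (M i))
      (fun i => P0Space (M i) k) (fun i => P1Space (M i) k) := by
  set C : ℝ := 8 * 2 ^ n + 2
  have hC : 0 < C := by positivity
  have hsqrt : ∀ i, ∀ τ ∈ P1Space (M i) k, √(quadForm (M i) τ τ) ≤ √C * ‖τ‖ := fun i τ hτ => by
    have := Real.sqrt_le_sqrt (hΩ.quadForm_le_norm_sq hτ.2)
    rwa [Real.sqrt_mul hC.le, Real.sqrt_sq (norm_nonneg τ)] at this
  refine ⟨fun i => ?_, ?_, ?_⟩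
  · exact
      { finiteDimensional := hΩ.finiteDimensional_of_le inf_le_right
        finiteDimensional' := hΩ.finiteDimensional_of_le inf_le_right
        le_domain := inf_le_left
        le_domain' := inf_le_left
        map_mem := fun τ hτ => extD_mem_P1MinusSpace hΩ (M i) τ hτ }
  · exact
      { add_left := fun i σ hσ σ' hσ' τ _ => hΩ.quadForm_add_left hσ.2 hσ'.2 τ
        smul_left := fun i c σ hσ τ _ => hΩ.quadForm_smul_left c hσ.2 τ
        symm := fun i σ _ τ _ => quadForm_comm (M i) σ τ
        bounded := ⟨C, hC, fun i σ hσ τ hτ => by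
          calc |quadForm (M i) σ τ|
              ≤ √(quadForm (M i) σ σ) * √(quadForm (M i) τ τ) := by
                rw [← Real.sqrt_mul (quadForm_self_nonneg _ _)]
                exact Real.abs_le_sqrt (hΩ.quadForm_sq_le hσ.2 hτ.2)
            _ ≤ (√C * ‖σ‖) * (√C * ‖τ‖) :=
                mul_le_mul (hsqrt i σ hσ) (hsqrt i τ hτ) (Real.sqrt_nonneg _) (by positivity)
            _ = √C * √C * ‖σ‖ * ‖τ‖ := by ring
            _ = C * ‖σ‖ * ‖τ‖ := by rw [Real.mul_self_sqrt hC.le]⟩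
        coercive := ⟨1, one_pos, fun i τ hτ => by
          rw [one_mul]; exact hΩ.norm_sq_le_quadForm hτ.2⟩
        norm_equiv := ⟨1, one_pos, √C, Real.sqrt_pos.2 hC, fun i τ hτ =>
          ⟨by rw [one_mul]; exact Real.le_sqrt_of_sq_le (hΩ.norm_sq_le_quadForm hτ.2),
            hsqrt i τ hτ⟩⟩ }
  · exact
      { finiteDimensional_Wh := fun i => hΩ.finiteDimensional_of_le le_rfl
        Vt_le := fun i => le_rfl
        exact := fun i τ hτ τ₀ hτ₀ => hΩ.inner_eq_quadForm hτ.2 hτ₀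
        -- Since the test space is the whole of `P₁Λ^k`, the projection is the identity.
        exists_map := ⟨fun i => LinearMap.id, fun i τ => ⟨τ.2.1, τ.2.1, rfl⟩,
          ⟨1, one_pos, fun i τ => by rw [one_mul]; exact le_rfl⟩, fun i τ τ₀ _ => rfl⟩ }
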